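/- Let $A$ be a finite dimensional algebra over a field, and let $\mathrm{mod}(A)$ be the category of finitely generated left $A$-modules; all subcategories of it are full and closed under isomorphisms. A subcategory $\mathcal C$ of $\mathrm{mod}(A)$ is *functorially finite* if for every $X\in\mathrm{mod}(A)$ there are $C_1,C_2\in\mathcal C$ and morphisms $g_1\colon X\to C_1$ and $g_2\colon C_2\to X$ such that $\mathrm{Hom}_A(g_1,C)$ and $\mathrm{Hom}_A(C,g_2)$ are surjective for all $C\in\mathcal C$. A *torsion class* is a subcategory that contains $0$ and is closed under quotients and extensions. A *wide subcategory* is a subcategory that contains $0$ and is closed under kernels, cokernels and extensions. Let $\text{f-tors}(A)$ and $\text{f-wide}(A)$ denote the classes of functorially finite torsion classes and of functorially finite wide subcategories of $\mathrm{mod}(A)$, respectively. For a subcategory $\mathcal C$, let $\mathrm{gen}(\mathcal C)$ consist of all quotients of finite direct sums of objects of $\mathcal C$, and let $\mathrm{filt}(\mathcal C)$ consist of all $X\in\mathrm{mod}(A)$ that have a finite filtration $0=F_0\subseteq F_1\subseteq\dots\subseteq F_n=X$ by submodules with $F_i/F_{i-1}\in\mathcal C$ for all $1\le i\le n$. For a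 torsion class $\mathcal T$ put $$\alpha(\mathcal T)=\{X\in\mathcal T\mid \ker(g)\in\mathcal T\text{ for every morphism } g\colon Y\to X\text{ with }Y\in\mathcal T\}.$$ **Proposition.** For every $\mathcal T\in\text{f-tors}(A)$ one has $\mathcal T=\mathrm{filt}(\mathrm{gen}(\alpha(\mathcal T)))$. Moreover, $\alpha(\mathcal T)\in\text{f-wide}(A)$ for every $\mathcal T\in\text{f-tors}(A)$, and the map $\mathcal T\mapsto\alpha(\mathcal T)$ from $\text{f-tors}(A)$ to $\text{f-wide}(A)$ is injective. -/

import Mathlib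

open CategoryTheory

universe u v

namespace ModCat

/-! For a ring `A`, the category `mod(A)` of finitely generated left `A`-modules is `FGModuleCat A`.
A full subcategory of `mod(A)` is given by its objects, that is, by a term of type
`ObjectProperty (FGModuleCat A)`. -/

variable {A : Type u} [Ring A]

/-- The `A`-module `M` lies in the (replete) subcategory `C`: it is isomorphic to an object
of `C`. -/
def Contains (C : ObjectProperty (FGModuleCat.{u} A))
    (M : Type u) [AddCommGroup M] [Module A M] : Prop :=
  ∃ Z : FGModuleCat.{u} A, C Z ∧ Nonempty (Z ≃ₗ[A] M)

/-- The morphism `g : X ⟶ Y` is a left `C`-approximation of `X`. -/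
def IsLeftApproximation (C : ObjectProperty (FGModuleCat.{u} A)) {X Y : FGModuleCat.{u} A}
    (g : X ⟶ Y) : Prop :=
  C Y ∧ ∀ Z : FGModuleCat.{u} A, C Z → Function.Surjective (fun h : Y ⟶ Z => g ≫ h)

/-- The morphism `g : Y ⟶ X` is a right `C`-approximation of `X`. -/
def IsRightApproximation (C : ObjectProperty (FGModuleCat.{u} A)) {X Y : FGModuleCat.{u} A}
    (g : Y ⟶ X) : Prop :=
  C Y ∧ ∀ Z : FGModuleCat.{u} A, C Z → Function.Surjective (fun h : Z ⟶ Y => h ≫ g)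

/-- Every module in `mod(A)` admits both a left and a right `C`-approximation. -/
def IsFunctoriallyFinite (C : ObjectProperty (FGModuleCat.{u} A)) : Prop :=
  ∀ X : FGModuleCat.{u} A,
    (∃ (Y : FGModuleCat.{u} A) (g : X ⟶ Y), IsLeftApproximation C g) ∧
    (∃ (Y : FGModuleCat.{u} A) (g : Y ⟶ X), IsRightApproximation C g)

/-- Torsion classes: subcategories containing `0` (this only excludes the empty subcategory) and
closed under quotients and extensions. They are replete, as they are closed under quotients. -/
structure IsTorsionClass (T : ObjectProperty (FGModuleCat.{u} A)) : Prop where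
  containsZero : T.ContainsZero
  quotients : T.IsClosedUnderQuotients
  extensions : T.IsClosedUnderExtensions

/-- Wide subcategories: exact abelian subcategories (they contain `0` and are closed under the
kernels and cokernels of `mod(A)`) that are closed under extensions. They are closed under finite
direct sums, as these are extensions, and replete, as kernels are taken up to isomorphism. -/
structure IsWide (W : ObjectProperty (FGModuleCat.{u} A)) : Prop where
  containsZero : W.ContainsZero
  kernels : W.IsClosedUnderKernels
  cokernels : W.IsClosedUnderCokernels
  extensions : W.IsClosedUnderExtensions

variable (A) in
/-- The class `f-tors(A)` of functorially finite torsion classes in `mod(A)`. -/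
def fTors : Set (ObjectProperty (FGModuleCat.{u} A)) :=
  {T | IsTorsionClass T ∧ IsFunctoriallyFinite T}

variable (A) in
/-- The class `f-wide(A)` of functorially finite wide subcategories of `mod(A)`. -/
def fWide : Set (ObjectProperty (FGModuleCat.{u} A)) :=
  {W | IsWide W ∧ IsFunctoriallyFinite W}

/-- `gen(C)`: all quotients of finite direct sums of objects of `C`. The finite direct sum
`M 0 ⊕ ⋯ ⊕ M (n - 1)` is realized as the product module. -/
def gen (C : ObjectProperty (FGModuleCat.{u} A)) : ObjectProperty (FGModuleCat.{u} A) :=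
  fun X => ∃ (n : ℕ) (M : Fin n → FGModuleCat.{u} A), (∀ i, C (M i)) ∧
    ∃ p : ((i : Fin n) → M i) →ₗ[A] X, Function.Surjective p

/-- `filt(C)`: all `X` in `mod(A)` with a finite filtration `0 = F 0 ⊆ F 1 ⊆ ⋯ ⊆ F n = X` by
submodules such that all `F (i + 1) / F i` lie in `C`. -/
def filt (C : ObjectProperty (FGModuleCat.{u} A)) : ObjectProperty (FGModuleCat.{u} A) :=
  fun X => ∃ (n : ℕ) (F : ℕ → Submodule A X), F 0 = ⊥ ∧ F n = ⊤ ∧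
    ∀ i < n, F i ≤ F (i + 1) ∧ Contains C (F (i + 1) ⧸ (F i).submoduleOf (F (i + 1)))

/-- `α(T)`: all `X` in `T` such that every morphism `g : Y ⟶ X` with `Y` in `T` has its kernel
in `T`. -/
def alpha (T : ObjectProperty (FGModuleCat.{u} A)) : ObjectProperty (FGModuleCat.{u} A) :=
  fun X => T X ∧ ∀ Y : FGModuleCat.{u} A, T Y → ∀ g : Y ⟶ X, Contains T (LinearMap.ker g.hom.hom)

end ModCat

/-! A functorially finite torsion class T has a left minimal left T-approximation A → G, 1 ↦ t, and
t detects α(T): a module M in T lies in α(T) exactly when no nonzero morphism G → M kills t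
(`eq_zero_of_apply_eq_zero`, `alpha_of_forall`). Let R be the sum of the images of the endomorphisms
of G killing t. Then P = G/R, with the class of t, is a generator of α(T) (`isGenerator_alpha`).

Every nonzero M in T receives a nonzero morphism from P: a nonzero f : G → M with f ∘ End(G) minimal
must kill R (`exists_alpha_map_ne_zero`). Stacking images of such morphisms filters each module of T
by quotients of P, so T = filt(gen(α(T))), and T is recovered from α(T).

Wideness follows from closure properties of T alone. A left α(T)-approximation comes from a left
T-approximation by dividing out the common kernel of all morphisms to α(T). A right one comes from a
map Pⁿ → X through which all morphisms P → X factor, by dividing out the trace of P in its kernel.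
-/

namespace ModCat

variable {A : Type u} [Ring A]

/-! ### Exactness in mod(A) in terms of linear maps -/

section Bridge

variable [IsNoetherianRing A]

theorem exact_iff_function_exact (S : ShortComplex (FGModuleCat.{u} A)) :
    S.Exact ↔ Function.Exact S.f.hom.hom S.g.hom.hom := by
  rw [← ShortComplex.exact_map_iff_of_faithful S (forget₂ (FGModuleCat.{u} A) (ModuleCat.{u} A)),
    ShortComplex.ShortExact.moduleCat_exact_iff_function_exact]
  rfl

theorem mono_iff_injective {X Y : FGModuleCat.{u} A} (f : X ⟶ Y) :
    Mono f ↔ Function.Injective f.hom.hom := by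
  rw [← (forget₂ (FGModuleCat.{u} A) (ModuleCat.{u} A)).mono_map_iff_mono,
    ModuleCat.mono_iff_injective]
  rfl

theorem epi_iff_surjective {X Y : FGModuleCat.{u} A} (f : X ⟶ Y) :
    Epi f ↔ Function.Surjective f.hom.hom := by
  rw [← (forget₂ (FGModuleCat.{u} A) (ModuleCat.{u} A)).epi_map_iff_epi,
    ModuleCat.epi_iff_surjective]
  rfl

theorem shortExact_iff (S : ShortComplex (FGModuleCat.{u} A)) :
    S.ShortExact ↔ Function.Injective S.f.hom.hom ∧ Function.Exact S.f.hom.hom S.g.hom.hom ∧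
      Function.Surjective S.g.hom.hom := by
  rw [← mono_iff_injective, ← exact_iff_function_exact, ← epi_iff_surjective]
  exact ⟨fun h => ⟨h.mono_f, h.exact, h.epi_g⟩, fun ⟨h₁, h₂, h₃⟩ =>
    { exact := h₂, mono_f := h₁, epi_g := h₃ }⟩

end Bridge

/-! ### Membership of unbundled modules, extensions and finite sums -/

section Contains

variable {C : ObjectProperty (FGModuleCat.{u} A)}
  {M N Q : Type u} [AddCommGroup M] [Module A M] [AddCommGroup N] [Module A N]
  [AddCommGroup Q] [Module A Q]

theorem Contains.finite (h : Contains C M) : Module.Finite A M := by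
  obtain ⟨Z, -, ⟨e⟩⟩ := h
  exact Module.Finite.equiv e

theorem Contains.congr (h : Contains C M) (e : M ≃ₗ[A] N) : Contains C N := by
  obtain ⟨Z, hZ, ⟨e'⟩⟩ := h
  exact ⟨Z, hZ, ⟨e'.trans e⟩⟩

theorem contains_of_prop {X : FGModuleCat.{u} A} (h : C X) : Contains C X :=
  ⟨X, h, ⟨LinearEquiv.refl A X⟩⟩

theorem Contains.prop [C.IsClosedUnderIsomorphisms] {X : FGModuleCat.{u} A}
    (h : Contains C X) : C X := by
  obtain ⟨Z, hZ, ⟨e⟩⟩ := h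
  exact C.prop_of_iso (e.toFGModuleCatIso : Z ≅ X) hZ

theorem contains_of_subsingleton (h0 : C.ContainsZero) [Subsingleton M] : Contains C M := by
  obtain ⟨Z, hZ, hC⟩ := h0.exists_zero
  have : Subsingleton Z := by
    refine ⟨fun x y => ?_⟩
    have h := hZ.eq_of_src (𝟙 Z) 0
    have h' : ∀ x : Z, x = 0 := fun x =>
      congrArg (fun f : Z ⟶ Z => f.hom.hom x) h
    rw [h' x, h' y]
  exact ⟨Z, hC, ⟨LinearEquiv.ofSubsingleton Z M⟩⟩

theorem Contains.of_exact [IsNoetherianRing A] (hC : C.IsClosedUnderExtensions)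
    (h₁ : Contains C M) (h₃ : Contains C Q)
    {f : M →ₗ[A] N} {g : N →ₗ[A] Q} (hf : Function.Injective f) (hfg : Function.Exact f g)
    (hg : Function.Surjective g) : Contains C N := by
  have := h₁.finite
  have := h₃.finite
  obtain ⟨Z₁, hZ₁, ⟨e₁⟩⟩ := h₁
  obtain ⟨Z₃, hZ₃, ⟨e₃⟩⟩ := h₃
  have : Module.Finite A N := by
    rw [Module.finite_def]
    refine Submodule.fg_of_fg_map_of_fg_inf_ker g ?_ ?_
    · rw [Submodule.map_top, LinearMap.range_eq_top.2 hg]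
      exact Module.Finite.fg_top
    · rw [top_inf_eq, hfg.linearMap_ker_eq, LinearMap.range_eq_map]
      exact Module.Finite.fg_top.map f
  let F : Z₁ ⟶ FGModuleCat.of A N := FGModuleCat.ofHom (f ∘ₗ e₁.toLinearMap)
  let G : FGModuleCat.of A N ⟶ Z₃ := FGModuleCat.ofHom (e₃.symm.toLinearMap ∘ₗ g)
  have hS : (ShortComplex.mk F G (by
      ext x
      change e₃.symm (g (f (e₁ x))) = 0
      rw [hfg.apply_apply_eq_zero, map_zero])).ShortExact := by
    rw [shortExact_iff]
    refine ⟨hf.comp e₁.injective, fun y => ?_, e₃.symm.surjective.comp hg⟩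
    change e₃.symm (g y) = 0 ↔ ∃ x, f (e₁ x) = y
    rw [LinearEquiv.map_eq_zero_iff, hfg y]
    exact (e₁.surjective.exists (p := fun x => f x = y))
  exact contains_of_prop (hC.prop_X₂_of_shortExact hS hZ₁ hZ₃)

theorem contains_pi [IsNoetherianRing A] (h0 : C.ContainsZero) (hC : C.IsClosedUnderExtensions)
    {n : ℕ} {M : Fin n → Type u} [∀ i, AddCommGroup (M i)] [∀ i, Module A (M i)]
    (h : ∀ i, Contains C (M i)) : Contains C ((i : Fin n) → M i) := by
  induction n with
  | zero => exact contains_of_subsingleton h0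
  | succ n ih =>
    refine (ih (M := fun i => M i.succ) fun i => h i.succ).of_exact hC (h 0)
      (f := LinearMap.pi (Fin.cons 0 fun i => LinearMap.proj i)) (g := LinearMap.proj 0) ?_ ?_ ?_
    · intro x y hxy
      ext i
      exact congrFun hxy i.succ
    · intro y
      constructor
      · intro hy
        refine ⟨fun i => y i.succ, ?_⟩
        ext i
        refine Fin.cases ?_ (fun i => ?_) i
        · exact hy.symm
        · rfl
      · rintro ⟨x, rfl⟩
        rfl
    · exact Function.surjective_eval 0

end Contains

theorem exists_comp_eq_of_ker_le {M N Q : Type*} [AddCommGroup M] [Module A M] [AddCommGroup N]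
    [Module A N] [AddCommGroup Q] [Module A Q] {q : M →ₗ[A] N} (hq : Function.Surjective q)
    (s : M →ₗ[A] Q) (h : LinearMap.ker q ≤ LinearMap.ker s) : ∃ g : N →ₗ[A] Q, g ∘ₗ q = s := by
  refine ⟨(LinearMap.ker q).liftQ s h ∘ₗ (q.quotKerEquivOfSurjective hq).symm.toLinearMap, ?_⟩
  ext x
  have : (q.quotKerEquivOfSurjective hq).symm (q x) = (LinearMap.ker q).mkQ x := by
    rw [LinearEquiv.symm_apply_eq]
    rfl
  simp [this]

/-! ### Torsion classes, and wideness of α(T) -/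

section TorsionClass

variable {T : ObjectProperty (FGModuleCat.{u} A)}
  {M N Q : Type u} [AddCommGroup M] [Module A M] [AddCommGroup N] [Module A N]
  [AddCommGroup Q] [Module A Q]

theorem IsTorsionClass.isClosedUnderIsomorphisms (hT : IsTorsionClass T) :
    T.IsClosedUnderIsomorphisms :=
  have := hT.quotients
  inferInstance

theorem contains_alpha_iff (hT : IsTorsionClass T) :
    Contains (alpha T) M ↔ Contains T M ∧ ∀ (Y : Type u) [AddCommGroup Y] [Module A Y],
      Contains T Y → ∀ g : Y →ₗ[A] M, Contains T (LinearMap.ker g) := by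
  have := hT.isClosedUnderIsomorphisms
  constructor
  · rintro ⟨Z, ⟨hZ, hZ'⟩, ⟨e⟩⟩
    refine ⟨⟨Z, hZ, ⟨e⟩⟩, fun Y _ _ hY g => ?_⟩
    have := hY.finite
    have h := hZ' (FGModuleCat.of A Y) (Contains.prop (hY : Contains T (FGModuleCat.of A Y)))
      (FGModuleCat.ofHom (e.symm.toLinearMap ∘ₗ g))
    have hk : LinearMap.ker (e.symm.toLinearMap ∘ₗ g) = LinearMap.ker g :=
      LinearEquiv.ker_comp _ _
    rw [← hk]
    exact h
  · rintro ⟨hM, h⟩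
    have := hM.finite
    refine contains_of_prop (X := FGModuleCat.of A M)
      ⟨Contains.prop (hM : Contains T (FGModuleCat.of A M)), fun Y hY g => ?_⟩
    exact h Y (contains_of_prop hY) g.hom.hom

theorem IsTorsionClass.alpha_le (hT : IsTorsionClass T) (h : Contains (alpha T) M) :
    Contains T M :=
  ((contains_alpha_iff hT).1 h).1

theorem IsTorsionClass.ker (hT : IsTorsionClass T) (hM : Contains T M)
    (h : Contains (alpha T) N) (g : M →ₗ[A] N) : Contains T (LinearMap.ker g) :=
  ((contains_alpha_iff hT).1 h).2 M hM g

theorem IsTorsionClass.alpha_isClosedUnderIsomorphisms (hT : IsTorsionClass T) :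
    (alpha T).IsClosedUnderIsomorphisms where
  of_iso {X Y} e hX := by
    have := hT.isClosedUnderIsomorphisms
    obtain ⟨h, h'⟩ := (contains_alpha_iff hT).1
      ((contains_of_prop hX).congr (FGModuleCat.isoToLinearEquiv e))
    exact ⟨h.prop, fun Z hZ g => h' Z (contains_of_prop hZ) g.hom.hom⟩

theorem IsTorsionClass.alpha_ker (hT : IsTorsionClass T) (hM : Contains (alpha T) M)
    (hN : Contains (alpha T) N) (f : M →ₗ[A] N) : Contains (alpha T) (LinearMap.ker f) := by
  refine (contains_alpha_iff hT).2 ⟨hT.ker (hT.alpha_le hM) hN f, fun Y _ _ hY g => ?_⟩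
  have h := hT.ker hY hM ((LinearMap.ker f).subtype ∘ₗ g)
  rwa [LinearMap.ker_comp_of_ker_eq_bot _ (Submodule.ker_subtype _)] at h

variable [IsNoetherianRing A]

theorem IsTorsionClass.of_surjective (hT : IsTorsionClass T) (h : Contains T M)
    (f : M →ₗ[A] N) (hf : Function.Surjective f) : Contains T N := by
  have := h.finite
  have := Module.Finite.of_surjective f hf
  obtain ⟨Z, hZ, ⟨e⟩⟩ := h
  let F : Z ⟶ FGModuleCat.of A N := FGModuleCat.ofHom (f ∘ₗ e.toLinearMap)
  have : Epi F := (epi_iff_surjective F).2 (hf.comp e.surjective)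
  exact contains_of_prop (hT.quotients.prop_of_epi F hZ)

theorem IsTorsionClass.range (hT : IsTorsionClass T) (h : Contains T M)
    (f : M →ₗ[A] N) : Contains T (LinearMap.range f) :=
  hT.of_surjective h f.rangeRestrict f.surjective_rangeRestrict

theorem IsTorsionClass.contains_sup (hT : IsTorsionClass T) {S S' : Submodule A M}
    (h : Contains T S) (h' : Contains T S') : Contains T ↥(S ⊔ S') := by
  have : Contains T (S × S') := h.of_exact hT.extensions h' (f := LinearMap.inl A S S')
    (g := LinearMap.snd A S S') LinearMap.inl_injective Function.Exact.inl_snd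
    LinearMap.snd_surjective
  have h2 := hT.range this (S.subtype.coprod S'.subtype)
  rwa [LinearMap.range_coprod, Submodule.range_subtype, Submodule.range_subtype] at h2

/-- M is Noetherian, so some submodule in T below the supremum is maximal; binary sums stay in T, so
it absorbs every member. -/
theorem IsTorsionClass.contains_sSup [Module.Finite A M] (hT : IsTorsionClass T)
    {𝒮 : Set (Submodule A M)} (h : ∀ S ∈ 𝒮, Contains T S) : Contains T ↥(sSup 𝒮) := by
  obtain ⟨S, ⟨hS, hST⟩, hmax⟩ := WellFounded.has_min
    (wellFounded_gt : WellFounded (fun S S' : Submodule A M => S > S'))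
    {S | S ≤ sSup 𝒮 ∧ Contains T S} ⟨⊥, bot_le, contains_of_subsingleton hT.containsZero⟩
  have : sSup 𝒮 ≤ S := sSup_le fun S' hS' => by
    by_contra hlt
    exact hmax (S ⊔ S') ⟨sup_le hS (le_sSup hS'), hT.contains_sup hST (h S' hS')⟩
      (left_lt_sup.2 hlt)
  rwa [le_antisymm hS this] at hST

/-- The pullback of a surjection with kernel in a torsion class `T` along a morphism with
source in `T` lies in `T`. -/
theorem IsTorsionClass.pullback (hT : IsTorsionClass T) {f : M →ₗ[A] N}
    (hf : Function.Surjective f) (hk : Contains T (LinearMap.ker f)) (hQ : Contains T Q)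
    (g : Q →ₗ[A] N) :
    Contains T (LinearMap.eqLocus (f ∘ₗ LinearMap.fst A M Q) (g ∘ₗ LinearMap.snd A M Q)) := by
  refine hk.of_exact hT.extensions hQ
    (f := LinearMap.codRestrict _ (LinearMap.inl A M Q ∘ₗ (LinearMap.ker f).subtype) ?_)
    (g := LinearMap.snd A M Q ∘ₗ Submodule.subtype _) ?_ ?_ ?_
  · intro x
    simp
  · intro x y hxy
    exact Subtype.ext (congrArg (fun w => w.1.1) hxy)
  · rintro ⟨⟨x, y⟩, hxy⟩
    have hxy' : f x = g y := hxy
    constructor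
    · intro h
      have hy : y = 0 := h
      subst hy
      exact ⟨⟨x, by simpa using hxy'⟩, rfl⟩
    · rintro ⟨z, hz⟩
      exact (congrArg (fun w => w.1.2) hz).symm
  · intro y
    obtain ⟨x, hx⟩ := hf (g y)
    exact ⟨⟨(x, y), hx⟩, rfl⟩

/-- The pullback E of f and g lies in T, and the kernel of its projection to M, in T because M is in
α(T), maps onto ker g. -/
theorem IsTorsionClass.alpha_of_surjective (hT : IsTorsionClass T) (hM : Contains (alpha T) M)
    {f : M →ₗ[A] N} (hf : Function.Surjective f) (hk : Contains T (LinearMap.ker f)) :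
    Contains (alpha T) N := by
  refine (contains_alpha_iff hT).2
    ⟨hT.of_surjective (hT.alpha_le hM) f hf, fun Y _ _ hY g => ?_⟩
  let E := LinearMap.eqLocus (f ∘ₗ LinearMap.fst A M Y) (g ∘ₗ LinearMap.snd A M Y)
  have h := hT.ker (hT.pullback hf hk hY g) hM (LinearMap.fst A M Y ∘ₗ E.subtype)
  refine hT.of_surjective h (LinearMap.codRestrict (LinearMap.ker g)
    (LinearMap.snd A M Y ∘ₗ E.subtype ∘ₗ Submodule.subtype _) ?_) ?_
  · rintro ⟨⟨⟨x, y⟩, hxy⟩, hx⟩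
    have hxy' : f x = g y := hxy
    have hx' : x = 0 := hx
    change g y = 0
    rw [← hxy', hx', map_zero]
  · rintro ⟨y, hy⟩
    have hy' : g y = 0 := hy
    exact ⟨⟨⟨(0, y), by simp [hy']⟩, rfl⟩, rfl⟩

theorem IsTorsionClass.alpha_quotient (hT : IsTorsionClass T) (hM : Contains (alpha T) M)
    {S : Submodule A M} (hS : Contains T S) : Contains (alpha T) (M ⧸ S) :=
  hT.alpha_of_surjective hM S.mkQ_surjective (by rwa [Submodule.ker_mkQ])

theorem IsTorsionClass.alpha_of_exact (hT : IsTorsionClass T)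
    (hM : Contains (alpha T) M) (hQ : Contains (alpha T) Q)
    {f : M →ₗ[A] N} {g : N →ₗ[A] Q} (hf : Function.Injective f) (hfg : Function.Exact f g)
    (hg : Function.Surjective g) : Contains (alpha T) N := by
  refine (contains_alpha_iff hT).2
    ⟨(hT.alpha_le hM).of_exact hT.extensions (hT.alpha_le hQ) hf hfg hg, fun Y _ _ hY h => ?_⟩
  have hK := hT.ker hY hQ (g ∘ₗ h)
  have hmem : ∀ y : LinearMap.ker (g ∘ₗ h), h y ∈ LinearMap.range f := fun y =>
    (hfg (h y)).1 y.2
  let k : LinearMap.ker (g ∘ₗ h) →ₗ[A] M := (LinearEquiv.ofInjective f hf).symm.toLinearMap ∘ₗ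
    LinearMap.codRestrict (LinearMap.range f) (h ∘ₗ Submodule.subtype _) hmem
  have hk : ∀ y, f (k y) = h y := fun y =>
    congrArg Subtype.val ((LinearEquiv.ofInjective f hf).apply_symm_apply ⟨h y, hmem y⟩)
  -- On ker (g ∘ h) the map h factors through M as k, so ker k and ker h agree.
  refine hT.of_surjective (hT.ker hK hM k) (LinearMap.codRestrict (LinearMap.ker h)
    (Submodule.subtype _ ∘ₗ Submodule.subtype _) ?_) ?_
  · rintro ⟨y, hy⟩
    have hy' : k y = 0 := hy
    change h y = 0
    rw [← hk, hy', map_zero]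
  · rintro ⟨y, hy⟩
    have hy' : h y = 0 := hy
    exact ⟨⟨⟨y, by simp [hy']⟩, hf ((hk _).trans (hy'.trans (map_zero f).symm))⟩, rfl⟩

open Limits in
theorem IsTorsionClass.isWide_alpha (hT : IsTorsionClass T) : IsWide (alpha T) where
  containsZero := by
    have := hT.isClosedUnderIsomorphisms
    obtain ⟨Z, hZ, hTZ⟩ := hT.containsZero.exists_zero
    refine ⟨Z, hZ, hTZ, fun Y hY g => (contains_of_prop hY).congr ?_⟩
    have : LinearMap.ker g.hom.hom = ⊤ := by
      rw [hZ.eq_of_tgt g 0]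
      exact LinearMap.ker_zero
    exact (LinearEquiv.ofTop _ this).symm
  kernels := by
    have := hT.alpha_isClosedUnderIsomorphisms
    refine ⟨?_⟩
    rintro _ ⟨f, k, hk, hX, hY⟩
    have hmono : Mono k.ι := Fork.IsLimit.mono hk
    have hex := (ShortComplex.mk k.ι f k.condition).exact_of_f_is_kernel
      (hk.ofIsoLimit (Fork.ext (Iso.refl _)))
    rw [exact_iff_function_exact] at hex
    rw [mono_iff_injective] at hmono
    have h := hT.alpha_ker (contains_of_prop hX) (contains_of_prop hY) f.hom.hom
    rw [hex.linearMap_ker_eq] at h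
    exact (h.congr (LinearEquiv.ofInjective k.ι.hom.hom hmono).symm).prop
  cokernels := by
    have := hT.alpha_isClosedUnderIsomorphisms
    refine ⟨?_⟩
    rintro _ ⟨f, k, hk, hX, hY⟩
    have hepi : Epi k.π := Cofork.IsColimit.epi hk
    have hex := (ShortComplex.mk f k.π k.condition).exact_of_g_is_cokernel
      (hk.ofIsoColimit (Cofork.ext (Iso.refl _)))
    rw [exact_iff_function_exact] at hex
    rw [epi_iff_surjective] at hepi
    refine (hT.alpha_of_surjective (contains_of_prop hY) hepi ?_).prop
    rw [hex.linearMap_ker_eq]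
    exact hT.range (hT.alpha_le (contains_of_prop hX)) f.hom.hom
  extensions := by
    have := hT.alpha_isClosedUnderIsomorphisms
    refine ⟨fun {S} hS h₁ h₃ => ?_⟩
    obtain ⟨hf, hfg, hg⟩ := (shortExact_iff S).1 hS
    exact (hT.alpha_of_exact (contains_of_prop h₁) (contains_of_prop h₃) hf hfg hg).prop

end TorsionClass

/-! ### Minimal generators and the criterion for α(T) -/

/-- The map `A → G`, `a ↦ a • t`, is a left `C`-approximation of the regular module. -/
structure IsGenerator (C : ObjectProperty (FGModuleCat.{u} A)) {G : Type u} [AddCommGroup G]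
    [Module A G] (t : G) : Prop where
  contains : Contains C G
  exists_map : ∀ (M : Type u) [AddCommGroup M] [Module A M], Contains C M → ∀ m : M,
    ∃ h : G →ₗ[A] M, h t = m

/-- The map `A → G`, `a ↦ a • t`, is a left minimal left `C`-approximation of the regular
module. -/
structure IsMinimalGenerator (C : ObjectProperty (FGModuleCat.{u} A)) {G : Type u}
    [AddCommGroup G] [Module A G] (t : G) : Prop extends IsGenerator C t where
  bijective : ∀ θ : G →ₗ[A] G, θ t = t → Function.Bijective θ

section Generator

variable {C T : ObjectProperty (FGModuleCat.{u} A)}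

theorem IsFunctoriallyFinite.exists_isGenerator (hC : IsFunctoriallyFinite C) :
    ∃ (G : FGModuleCat.{u} A) (t : G), IsGenerator C t := by
  obtain ⟨Y, g, hY, hg⟩ := (hC (FGModuleCat.of A A)).1
  refine ⟨Y, g.hom.hom (1 : A), contains_of_prop hY, fun M _ _ hM m => ?_⟩
  obtain ⟨Z, hZ, ⟨e⟩⟩ := hM
  obtain ⟨h, hh⟩ := hg Z hZ (FGModuleCat.ofHom (LinearMap.toSpanSingleton A Z (e.symm m)))
  refine ⟨e.toLinearMap ∘ₗ h.hom.hom, ?_⟩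
  have := congrArg (fun k => k.hom.hom (1 : A)) hh
  change h.hom.hom (g.hom.hom (1 : A)) = (1 : A) • e.symm m at this
  simp [this]

variable {G : Type u} [AddCommGroup G] [Module A G] {t : G}

theorem IsGenerator.exists_surjective (hG : IsGenerator C t) (M : Type u) [AddCommGroup M]
    [Module A M] (hM : Contains C M) :
    ∃ (n : ℕ) (q : (Fin n → G) →ₗ[A] M), Function.Surjective q := by
  have := hM.finite
  obtain ⟨n, s, hs⟩ := Module.Finite.exists_fin (R := A) (M := M)
  choose h hh using fun i => hG.exists_map M hM (s i)
  refine ⟨n, LinearMap.lsum A (fun _ => G) ℕ h, ?_⟩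
  rw [← LinearMap.range_eq_top, ← top_le_iff, ← hs, Submodule.span_le]
  rintro _ ⟨i, rfl⟩
  refine ⟨Pi.single i t, ?_⟩
  rw [LinearMap.lsum_piSingle, hh]

variable {M N : Type u} [AddCommGroup M] [Module A M] [AddCommGroup N] [Module A N]

/-- Since ker φ lies in T and contains t, some endomorphism of G fixes t and has image in ker φ; by
minimality it is bijective. -/
theorem IsMinimalGenerator.eq_zero_of_apply_eq_zero (hG : IsMinimalGenerator T t)
    (hT : IsTorsionClass T) (hM : Contains (alpha T) M) (φ : G →ₗ[A] M) (hφ : φ t = 0) :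
    φ = 0 := by
  obtain ⟨θ, hθ⟩ := hG.exists_map _ (hT.ker hG.contains hM φ) ⟨t, hφ⟩
  have hb := hG.bijective (Submodule.subtype _ ∘ₗ θ) (by simp [hθ])
  ext x
  obtain ⟨z, rfl⟩ := hb.2 x
  exact (θ z).2

variable [IsNoetherianRing A]

/-- Take a minimal submodule of an approximation that still carries a generator s. The image of an
endomorphism fixing s carries one too, so the endomorphism is onto, hence bijective. -/
theorem IsTorsionClass.exists_isMinimalGenerator [IsArtinianRing A] (hT : IsTorsionClass T)
    (hf : IsFunctoriallyFinite T) :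
    ∃ (G : Type u) (_ : AddCommGroup G) (_ : Module A G) (t : G), IsMinimalGenerator T t := by
  obtain ⟨Y, y, hy⟩ := hf.exists_isGenerator
  obtain ⟨S, ⟨s, hs⟩, hmin⟩ := WellFounded.has_min
    (wellFounded_lt : WellFounded (fun S S' : Submodule A Y => S < S'))
    {S | ∃ s : S, IsGenerator T s}
    ⟨LinearMap.range (LinearMap.id : Y →ₗ[A] Y), ⟨y, y, rfl⟩,
      hT.range hy.contains _, fun M _ _ hM m => by
        obtain ⟨h, hh⟩ := hy.exists_map M hM m
        exact ⟨h ∘ₗ Submodule.subtype _, hh⟩⟩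
  refine ⟨S, inferInstance, inferInstance, s, hs, fun θ hθ => ?_⟩
  have hle : LinearMap.range (S.subtype ∘ₗ θ) ≤ S := by
    rintro _ ⟨x, rfl⟩
    exact (θ x).2
  have hgen : IsGenerator T (⟨s, s, congrArg Subtype.val hθ⟩ :
      LinearMap.range (S.subtype ∘ₗ θ)) := by
    refine ⟨hT.range hs.contains _, fun M _ _ hM m => ?_⟩
    obtain ⟨h, hh⟩ := hs.exists_map M hM m
    exact ⟨h ∘ₗ Submodule.inclusion hle, hh⟩
  have hsurj : Function.Surjective θ := by
    have h : LinearMap.range (S.subtype ∘ₗ θ) = S := by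
      by_contra hne
      exact hmin _ ⟨_, hgen⟩ (lt_of_le_of_ne hle hne)
    intro x
    have hx : (x : Y) ∈ LinearMap.range (S.subtype ∘ₗ θ) := h.symm ▸ x.2
    obtain ⟨z, hz⟩ := hx
    exact ⟨z, Subtype.ext hz⟩
  exact IsNoetherian.bijective_of_surjective_endomorphism θ hsurj

/-- For a torsion class `T` and a `T`-generator `t`, a module `M` in `T` lies in `α(T)` as soon
as no nonzero morphism to `M` kills `t`. -/
theorem IsGenerator.alpha_of_forall (hG : IsGenerator T t) (hT : IsTorsionClass T)
    (hM : Contains T M) (h : ∀ φ : G →ₗ[A] M, φ t = 0 → φ = 0) : Contains (alpha T) M := by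
  refine (contains_alpha_iff hT).2 ⟨hM, fun Y _ _ hY g => ?_⟩
  have := hY.finite
  -- If φ t = y lies in ker g, then g ∘ φ kills t and vanishes, so ker g is a sum of images of G.
  have hk : LinearMap.ker g =
      sSup {S | ∃ φ : G →ₗ[A] Y, g ∘ₗ φ = 0 ∧ S = LinearMap.range φ} := by
    refine le_antisymm (fun y hy => ?_) (sSup_le ?_)
    · obtain ⟨φ, hφ⟩ := hG.exists_map Y hY y
      have h0 : g ∘ₗ φ = 0 := h _ (by simpa [hφ] using hy)
      have hle : LinearMap.range φ ≤
          sSup {S | ∃ φ : G →ₗ[A] Y, g ∘ₗ φ = 0 ∧ S = LinearMap.range φ} := le_sSup ⟨φ, h0, rfl⟩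
      exact hle ⟨t, hφ⟩
    · rintro _ ⟨φ, hφ, rfl⟩
      exact LinearMap.range_le_ker_iff.2 hφ
  rw [hk]
  refine hT.contains_sSup ?_
  rintro _ ⟨φ, -, rfl⟩
  exact hT.range hG.contains φ

/-- Morphisms out of a minimal generator that kill `t` lift along surjections with kernel
in `T`. -/
theorem IsMinimalGenerator.exists_lift (hG : IsMinimalGenerator T t) (hT : IsTorsionClass T)
    {f : M →ₗ[A] N} (hf : Function.Surjective f) (hk : Contains T (LinearMap.ker f))
    (φ : G →ₗ[A] N) (hφ : φ t = 0) : ∃ ψ : G →ₗ[A] M, ψ t = 0 ∧ f ∘ₗ ψ = φ := by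
  let E := LinearMap.eqLocus (f ∘ₗ LinearMap.fst A M G) (φ ∘ₗ LinearMap.snd A M G)
  -- The composite G → E → G fixes t, so it is invertible and splits the projection of the pullback.
  obtain ⟨σ, hσ⟩ := hG.exists_map E (hT.pullback hf hk hG.contains φ) ⟨(0, t), (map_zero f).trans hφ.symm⟩
  let e := LinearEquiv.ofBijective (LinearMap.snd A M G ∘ₗ E.subtype ∘ₗ σ)
    (hG.bijective _ (congrArg (fun w => w.1.2) hσ))
  have het : e.symm t = t := by
    rw [LinearEquiv.symm_apply_eq]
    exact (congrArg (fun w => w.1.2) hσ).symm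
  refine ⟨LinearMap.fst A M G ∘ₗ E.subtype ∘ₗ σ ∘ₗ e.symm.toLinearMap, by simp [het, hσ], ?_⟩
  ext x
  have h : f (σ (e.symm x)).1.1 = φ (σ (e.symm x)).1.2 := (σ (e.symm x)).2
  have h' : (σ (e.symm x)).1.2 = x := e.apply_symm_apply x
  rw [h'] at h
  exact h

/-- The quotient of a minimal generator by the trace of the cokernel of `A → G` in `G`. -/
theorem IsMinimalGenerator.isGenerator_alpha (hG : IsMinimalGenerator T t)
    (hT : IsTorsionClass T) : IsGenerator (alpha T)
      ((sSup {S | ∃ e : G →ₗ[A] G, e t = 0 ∧ S = LinearMap.range e}).mkQ t) := by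
  have := hG.contains.finite
  set R := sSup {S | ∃ e : G →ₗ[A] G, e t = 0 ∧ S = LinearMap.range e} with hR
  have hle : ∀ e : G →ₗ[A] G, e t = 0 → LinearMap.range e ≤ R := fun e he =>
    le_sSup ⟨e, he, rfl⟩
  have hRT : Contains T R := by
    refine hT.contains_sSup ?_
    rintro _ ⟨φ, -, rfl⟩
    exact hT.range hG.contains φ
  constructor
  · refine hG.alpha_of_forall hT (hT.of_surjective hG.contains _ R.mkQ_surjective)
      fun φ hφ => ?_
    obtain ⟨ψ, hψ, rfl⟩ := hG.exists_lift hT R.mkQ_surjective (by rwa [Submodule.ker_mkQ]) φ hφ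
    rw [← LinearMap.range_le_ker_iff, Submodule.ker_mkQ]
    exact hle ψ hψ
  · intro M _ _ hM m
    obtain ⟨h, hh⟩ := hG.exists_map M (hT.alpha_le hM) m
    refine ⟨R.liftQ h (sSup_le ?_), by simp [hh]⟩
    rintro _ ⟨e, he, rfl⟩
    exact LinearMap.range_le_ker_iff.2
      (hG.eq_zero_of_apply_eq_zero hT hM (h ∘ₗ e) (by simp [he]))

end Generator

/-! ### Finite dimensionality of Hom spaces -/

section FiniteDimensional

variable {G X : Type u} [AddCommGroup G] [Module A G] [AddCommGroup X] [Module A X]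

theorem finite_linearMap_of_finite (K : Type v) [Field K] [Algebra K A]
    [Module K G] [IsScalarTower K A G] [Module.Finite K G]
    [Module K X] [IsScalarTower K A X] [Module.Finite K X] : Module.Finite K (G →ₗ[A] X) :=
  Module.Finite.of_injective (LinearMap.restrictScalarsₗ K A G X K)
    (LinearMap.restrictScalars_injective K)

/-- Choose f ≠ 0 with the K-subspace f ∘ End(G) minimal; if f ∘ e ≠ 0, it generates the same
subspace. -/
theorem exists_comp_comp_eq (K : Type v) [Field K] [Algebra K A]
    [Module K G] [IsScalarTower K A G] [Module.Finite K G]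
    [Module K X] [IsScalarTower K A X] [Module.Finite K X]
    {f₀ : G →ₗ[A] X} (h₀ : f₀ ≠ 0) : ∃ f : G →ₗ[A] X, f ≠ 0 ∧
    ∀ e : G →ₗ[A] G, f ∘ₗ e ≠ 0 → ∃ e' : G →ₗ[A] G, f ∘ₗ e ∘ₗ e' = f := by
  have := finite_linearMap_of_finite (A := A) K (G := G) (X := X)
  let S : (G →ₗ[A] X) → Submodule K (G →ₗ[A] X) := fun f =>
    LinearMap.range (LinearMap.compRight K f : (G →ₗ[A] G) →ₗ[K] G →ₗ[A] X)
  obtain ⟨f, hf, hmin⟩ := WellFounded.has_min (InvImage.wf S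
    (wellFounded_lt : WellFounded (fun S S' : Submodule K (G →ₗ[A] X) => S < S')))
    {f | f ≠ 0} ⟨f₀, h₀⟩
  refine ⟨f, hf, fun e he => ?_⟩
  have hle : S (f ∘ₗ e) ≤ S f := by
    rintro _ ⟨e', rfl⟩
    exact ⟨e ∘ₗ e', rfl⟩
  have heq : S (f ∘ₗ e) = S f := by
    by_contra hne
    exact hmin _ he (lt_of_le_of_ne hle hne)
  obtain ⟨e', he'⟩ : f ∈ S (f ∘ₗ e) := heq ▸ ⟨LinearMap.id, rfl⟩
  exact ⟨e', he'⟩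

theorem exists_finite_generators_hom (K : Type v) [Field K] [Algebra K A]
    [Module K G] [IsScalarTower K A G] [Module.Finite K G]
    [Module K X] [IsScalarTower K A X] [Module.Finite K X] :
    ∃ (n : ℕ) (π : Fin n → (G →ₗ[A] X)),
    ∀ f : G →ₗ[A] X, ∃ c : Fin n → (G →ₗ[A] G), f = ∑ i, π i ∘ₗ c i := by
  have := finite_linearMap_of_finite (A := A) K (G := G) (X := X)
  obtain ⟨n, π, hπ⟩ := Module.Finite.exists_fin (R := K) (M := G →ₗ[A] X)
  refine ⟨n, π, fun f => ?_⟩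
  obtain ⟨c, hc⟩ := (Submodule.mem_span_range_iff_exists_fun K).1
    (hπ ▸ Submodule.mem_top : f ∈ Submodule.span K (Set.range π))
  refine ⟨fun i => c i • LinearMap.id, ?_⟩
  rw [← hc]
  refine Finset.sum_congr rfl fun i _ => ?_
  ext x
  simp

end FiniteDimensional

/-! ### Filtrations by quotients -/

section Filtration

variable {C T : ObjectProperty (FGModuleCat.{u} A)}
  {M N : Type u} [AddCommGroup M] [Module A M] [AddCommGroup N] [Module A N]

theorem Contains.gen_of_surjective (h : Contains C M) (f : M →ₗ[A] N)
    (hf : Function.Surjective f) : Contains (gen C) N := by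
  have := h.finite
  have := Module.Finite.of_surjective f hf
  obtain ⟨Z, hZ, ⟨e⟩⟩ := h
  refine contains_of_prop (X := FGModuleCat.of A N) ⟨1, fun _ => Z, fun _ => hZ,
    f ∘ₗ e.toLinearMap ∘ₗ LinearMap.proj 0, ?_⟩
  exact hf.comp (e.surjective.comp (Function.surjective_eval 0))

variable [IsNoetherianRing A]

theorem IsTorsionClass.contains_of_gen (hT : IsTorsionClass T)
    (hC : ∀ X, C X → T X) (h : Contains (gen C) M) : Contains T M := by
  obtain ⟨Z, ⟨n, M, hM, p, hp⟩, ⟨e⟩⟩ := h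
  exact (hT.of_surjective (contains_pi hT.containsZero hT.extensions
    fun i => contains_of_prop (hC _ (hM i))) p hp).congr e

theorem IsTorsionClass.prop_of_filt (hT : IsTorsionClass T)
    (hC : ∀ (M : Type u) [AddCommGroup M] [Module A M], Contains C M → Contains T M)
    {X : FGModuleCat.{u} A} (h : filt C X) : T X := by
  have := hT.isClosedUnderIsomorphisms
  obtain ⟨n, F, h0, hn, hF⟩ := h
  have key : ∀ i ≤ n, Contains T (F i) := by
    intro i
    induction i with
    | zero =>
      intro _
      rw [h0]
      exact contains_of_subsingleton hT.containsZero
    | succ i ih =>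
      intro hi
      obtain ⟨hle, hq⟩ := hF i hi
      refine (ih (by omega)).of_exact hT.extensions (hC _ hq)
        (f := Submodule.inclusion hle) (g := Submodule.mkQ _)
        (Submodule.inclusion_injective hle) ?_ (Submodule.mkQ_surjective _)
      rw [LinearMap.exact_iff, Submodule.ker_mkQ, Submodule.range_inclusion]
      rfl
  have h := key n le_rfl
  rw [hn] at h
  exact (h.congr Submodule.topEquiv).prop

theorem IsTorsionClass.filt_of_forall_exists_ne_zero (hT : IsTorsionClass T)
    {P : Type u} [AddCommGroup P] [Module A P] (hP : Contains C P)
    (h : ∀ (M : Type u) [AddCommGroup M] [Module A M], Contains T M → Nontrivial M →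
      ∃ φ : P →ₗ[A] M, φ ≠ 0) {X : FGModuleCat.{u} A} (hX : T X) : filt (gen C) X := by
  have key : ∀ S : Submodule A X, ∃ (n : ℕ) (F : ℕ → Submodule A X), F 0 = S ∧ F n = ⊤ ∧
      ∀ i < n, F i ≤ F (i + 1) ∧
        Contains (gen C) (F (i + 1) ⧸ (F i).submoduleOf (F (i + 1))) := by
    intro S
    induction S using WellFoundedGT.induction with
    | ind S ih =>
    by_cases hS : S = ⊤
    · exact ⟨0, fun _ => S, rfl, hS, fun i hi => absurd hi (Nat.not_lt_zero i)⟩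
    · obtain ⟨φ, hφ⟩ := h (X ⧸ S) (hT.of_surjective (contains_of_prop hX) _ S.mkQ_surjective)
        (Submodule.Quotient.nontrivial_iff.2 hS)
      -- S'/S is the image of φ, a nonzero quotient of P; ascending from S terminates because X is
      -- Noetherian.
      let S' := (LinearMap.range φ).comap S.mkQ
      have hle : S ≤ S' := by
        rw [← Submodule.ker_mkQ S]
        exact LinearMap.ker_le_comap S.mkQ
      have hlt : S < S' := by
        refine lt_of_le_of_ne hle fun heq => hφ ?_
        have hmap : S'.map S.mkQ = LinearMap.range φ :=
          Submodule.map_comap_eq_of_surjective S.mkQ_surjective _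
        rw [← heq, Submodule.mkQ_map_self] at hmap
        exact LinearMap.range_eq_bot.1 hmap.symm
      obtain ⟨n, F, h0, hn, hF⟩ := ih S' hlt
      refine ⟨n + 1, fun i => Nat.casesOn i S F, rfl, hn, fun i hi => ?_⟩
      cases i with
      | succ i => exact hF i (by omega)
      | zero =>
        change S ≤ F 0 ∧ Contains (gen C) (F 0 ⧸ S.submoduleOf (F 0))
        rw [h0]
        refine ⟨hle, ?_⟩
        let ψ : S' →ₗ[A] LinearMap.range φ :=
          LinearMap.codRestrict _ (S.mkQ ∘ₗ S'.subtype) fun x => x.2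
        have hψ : Function.Surjective ψ := by
          rintro ⟨y, hy⟩
          obtain ⟨x, rfl⟩ := S.mkQ_surjective y
          exact ⟨⟨x, hy⟩, rfl⟩
        have hk : LinearMap.ker ψ = S.submoduleOf S' := by
          refine (LinearMap.ker_codRestrict ..).trans ?_
          rw [LinearMap.ker_comp, Submodule.ker_mkQ]
          rfl
        rw [← hk]
        refine hP.gen_of_surjective
          ((ψ.quotKerEquivOfSurjective hψ).symm.toLinearMap ∘ₗ φ.rangeRestrict) ?_
        exact (ψ.quotKerEquivOfSurjective hψ).symm.surjective.comp φ.surjective_rangeRestrict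
  obtain ⟨n, F, h0, hn, hF⟩ := key ⊥
  exact ⟨n, F, h0, hn, hF⟩

end Filtration

/-! ### Nonzero morphisms from P, and approximations by α(T) -/

section Approximation

variable {T : ObjectProperty (FGModuleCat.{u} A)}
  {G P : Type u} [AddCommGroup G] [Module A G] [AddCommGroup P] [Module A P]

theorem IsMinimalGenerator.exists_alpha_map_ne_zero [IsNoetherianRing A]
    (K : Type v) [Field K] [Algebra K A] [FiniteDimensional K A]
    {t : G} (hG : IsMinimalGenerator T t)
    (M : Type u) [AddCommGroup M] [Module A M] (hM : Contains T M) [Nontrivial M] :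
    ∃ φ : (G ⧸ sSup {S | ∃ e : G →ₗ[A] G, e t = 0 ∧ S = LinearMap.range e}) →ₗ[A] M,
      φ ≠ 0 := by
  have := hG.contains.finite
  have := hM.finite
  let : Module K G := Module.compHom G (algebraMap K A)
  let : Module K M := Module.compHom M (algebraMap K A)
  have : IsScalarTower K A G := IsScalarTower.of_compHom K A G
  have : IsScalarTower K A M := IsScalarTower.of_compHom K A M
  have : Module.Finite K G := Module.Finite.trans A G
  have : Module.Finite K M := Module.Finite.trans A M
  obtain ⟨m, hm⟩ := exists_ne (0 : M)
  obtain ⟨f₀, h₀⟩ := hG.exists_map M hM m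
  have hf₀ : f₀ ≠ 0 := by
    rintro rfl
    exact hm h₀.symm
  obtain ⟨f, hf, hmin⟩ := exists_comp_comp_eq K hf₀
  have hkill : ∀ e : G →ₗ[A] G, e t = 0 → f ∘ₗ e = 0 := by
    intro e he
    by_contra hne
    obtain ⟨e', he'⟩ := hmin e hne
    -- As e t = 0, this endomorphism fixes t; f ∘ e ∘ e' = f makes f ∘ e vanish on its image, which
    -- is all of G.
    have hb := hG.bijective (LinearMap.id - e' ∘ₗ e) (by simp [he])
    refine hne (LinearMap.ext fun x => ?_)
    obtain ⟨z, rfl⟩ := hb.2 x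
    have h : f (e (e' (e z))) = f (e z) := LinearMap.congr_fun he' (e z)
    simp [h]
  have hle : sSup {S | ∃ e : G →ₗ[A] G, e t = 0 ∧ S = LinearMap.range e} ≤ LinearMap.ker f := by
    refine sSup_le ?_
    rintro _ ⟨e, he, rfl⟩
    exact LinearMap.range_le_ker_iff.2 (hkill e he)
  refine ⟨Submodule.liftQ _ f hle, fun h => hf ?_⟩
  rw [← Submodule.liftQ_mkQ _ f hle, h, LinearMap.zero_comp]

variable [IsNoetherianRing A]

theorem IsMinimalGenerator.exists_isLeftApproximation_alpha {t : G}
    (hG : IsMinimalGenerator T t) (hT : IsTorsionClass T) (hf : IsFunctoriallyFinite T)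
    (X : FGModuleCat.{u} A) :
    ∃ (Y : FGModuleCat.{u} A) (g : X ⟶ Y), IsLeftApproximation (alpha T) g := by
  have := hT.alpha_isClosedUnderIsomorphisms
  obtain ⟨Y, g, hY, hg⟩ := (hf X).1
  let R : Submodule A Y := sInf {S | ∃ (Z : FGModuleCat.{u} A) (_ : alpha T Z) (h : Y →ₗ[A] Z),
    S = LinearMap.ker h}
  have hR : ∀ (Z : FGModuleCat.{u} A) (_ : alpha T Z) (h : Y →ₗ[A] Z), R ≤ LinearMap.ker h :=
    fun Z hZ h => sInf_le ⟨Z, hZ, h, rfl⟩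
  have hα : Contains (alpha T) (Y ⧸ R) := by
    refine hG.alpha_of_forall hT
      (hT.of_surjective (contains_of_prop hY) _ R.mkQ_surjective) fun φ hφ => ?_
    ext x
    obtain ⟨y, hy⟩ := R.mkQ_surjective (φ x)
    rw [← hy, LinearMap.zero_apply, ← LinearMap.mem_ker, Submodule.ker_mkQ]
    refine (Submodule.mem_sInf).2 ?_
    rintro _ ⟨Z, hZ, h, rfl⟩
    -- Any φ killing t dies in every Z of α(T), and such Z jointly separate the points of Y/R.
    have h0 := hG.eq_zero_of_apply_eq_zero hT (contains_of_prop hZ)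
      (R.liftQ h (hR Z hZ h) ∘ₗ φ) (by simp [hφ])
    have h1 := LinearMap.congr_fun h0 x
    rw [LinearMap.comp_apply, ← hy] at h1
    exact h1
  refine ⟨FGModuleCat.of A (Y ⧸ R), g ≫ FGModuleCat.ofHom R.mkQ, Contains.prop hα,
    fun Z hZ k => ?_⟩
  obtain ⟨h, rfl⟩ := hg Z hZ.1 k
  exact ⟨FGModuleCat.ofHom (R.liftQ h.hom.hom (hR Z hZ h.hom.hom)), rfl⟩

theorem IsGenerator.exists_isRightApproximation_alpha
    (K : Type v) [Field K] [Algebra K A] [FiniteDimensional K A] {p : P}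
    (hP : IsGenerator (alpha T) p) (hT : IsTorsionClass T) (X : FGModuleCat.{u} A) :
    ∃ (Y : FGModuleCat.{u} A) (g : Y ⟶ X), IsRightApproximation (alpha T) g := by
  have := hT.alpha_isClosedUnderIsomorphisms
  have := hP.contains.finite
  have hW := hT.isWide_alpha
  let : Module K P := Module.compHom P (algebraMap K A)
  let : Module K X := Module.compHom X (algebraMap K A)
  have : IsScalarTower K A P := IsScalarTower.of_compHom K A P
  have : IsScalarTower K A X := IsScalarTower.of_compHom K A X
  have : Module.Finite K P := Module.Finite.trans A P
  have : Module.Finite K X := Module.Finite.trans A X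
  obtain ⟨n, π, hπ⟩ := exists_finite_generators_hom (A := A) K (G := P) (X := X)
  let pr : (Fin n → P) →ₗ[A] X := LinearMap.lsum A (fun _ => P) ℕ π
  have hpr : ∀ f : P →ₗ[A] X, ∃ s : P →ₗ[A] (Fin n → P), pr ∘ₗ s = f := fun f => by
    obtain ⟨c, rfl⟩ := hπ f
    refine ⟨LinearMap.pi c, ?_⟩
    ext x
    simp [pr, LinearMap.lsum_apply]
  let R := sSup {S | ∃ φ : P →ₗ[A] (Fin n → P), pr ∘ₗ φ = 0 ∧ S = LinearMap.range φ}
  have hR : ∀ φ : P →ₗ[A] (Fin n → P), pr ∘ₗ φ = 0 → LinearMap.range φ ≤ R := fun φ hφ =>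
    le_sSup ⟨φ, hφ, rfl⟩
  have hα : Contains (alpha T) ((Fin n → P) ⧸ R) := by
    refine hT.alpha_quotient (contains_pi hW.containsZero hW.extensions fun _ => hP.contains)
      (hT.contains_sSup ?_)
    rintro _ ⟨φ, -, rfl⟩
    exact hT.range (hT.alpha_le hP.contains) φ
  have hRpr : R ≤ LinearMap.ker pr := sSup_le (by
    rintro _ ⟨φ, hφ, rfl⟩
    exact LinearMap.range_le_ker_iff.2 hφ)
  refine ⟨FGModuleCat.of A ((Fin n → P) ⧸ R), FGModuleCat.ofHom (R.liftQ pr hRpr),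
    Contains.prop hα, fun Z hZ k => ?_⟩
  have hZ' : Contains (alpha T) Z := contains_of_prop hZ
  obtain ⟨d, q, hq⟩ := hP.exists_surjective Z hZ'
  choose s hs using fun i : Fin d => hpr (k.hom.hom ∘ₗ q ∘ₗ LinearMap.single A (fun _ => P) i)
  let σ : (Fin d → P) →ₗ[A] (Fin n → P) := LinearMap.lsum A (fun _ => P) ℕ s
  have hσ : pr ∘ₗ σ = k.hom.hom ∘ₗ q := by
    refine LinearMap.pi_ext' fun i => ?_
    rw [LinearMap.comp_assoc, LinearMap.comp_assoc, ← hs i]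
    congr 1
    ext x : 1
    exact LinearMap.lsum_piSingle ..
  -- ker q lies in α(T), so each z in it is the image of p under some P → ker q; followed by σ this
  -- lands in ker pr, hence in R.
  have hker : LinearMap.ker q ≤ LinearMap.ker (R.mkQ ∘ₗ σ) := fun z hz => by
    obtain ⟨φ, hφ⟩ := hP.exists_map _ (hT.alpha_ker
      (contains_pi hW.containsZero hW.extensions fun _ => hP.contains) hZ' q) ⟨z, hz⟩
    have h0 : pr ∘ₗ (σ ∘ₗ (LinearMap.ker q).subtype ∘ₗ φ) = 0 := by
      ext x
      have := LinearMap.congr_fun hσ (φ x)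
      simp only [LinearMap.comp_apply] at this
      simp [this]
    have hmem : σ z ∈ R := hR _ h0 ⟨p, by simp [hφ]⟩
    simpa using hmem
  obtain ⟨h, hh⟩ := exists_comp_eq_of_ker_le hq _ hker
  refine ⟨FGModuleCat.ofHom h, ?_⟩
  ext z
  obtain ⟨y, rfl⟩ := hq z
  have h1 := LinearMap.congr_fun hh y
  have h2 := LinearMap.congr_fun hσ y
  change R.liftQ pr hRpr (h (q y)) = k.hom.hom (q y)
  simp only [LinearMap.comp_apply] at h1 h2
  rw [h1, ← h2]
  rfl

end Approximation

end ModCat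

theorem proposition3p7 (K : Type v) [Field K] (A : Type u) [Ring A] [Algebra K A]
    [FiniteDimensional K A] :
    (∀ T ∈ ModCat.fTors A, T = ModCat.filt (ModCat.gen (ModCat.alpha T))) ∧
      Set.MapsTo ModCat.alpha (ModCat.fTors A) (ModCat.fWide A) ∧
      Set.InjOn ModCat.alpha (ModCat.fTors A) := by
  have : IsArtinianRing A := IsArtinianRing.of_finite K A
  have : IsNoetherianRing A := IsNoetherianRing.of_finite K A
  have hfilt : ∀ T ∈ ModCat.fTors A, T = ModCat.filt (ModCat.gen (ModCat.alpha T)) := by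
    rintro T ⟨hT, hf⟩
    obtain ⟨G, _, _, t, hG⟩ := hT.exists_isMinimalGenerator hf
    ext X
    refine ⟨fun hX => hT.filt_of_forall_exists_ne_zero (hG.isGenerator_alpha hT).contains
      (fun M _ _ hM _ => hG.exists_alpha_map_ne_zero K M hM) hX, fun hX => ?_⟩
    exact hT.prop_of_filt (fun M _ _ hM => hT.contains_of_gen (fun X hX => hX.1) hM) hX
  refine ⟨hfilt, ?_, ?_⟩
  · rintro T ⟨hT, hf⟩
    obtain ⟨G, _, _, t, hG⟩ := hT.exists_isMinimalGenerator hf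
    exact ⟨hT.isWide_alpha, fun X => ⟨hG.exists_isLeftApproximation_alpha hT hf X,
      (hG.isGenerator_alpha hT).exists_isRightApproximation_alpha K hT X⟩⟩
  · intro T hT T' hT' h
    rw [hfilt T hT, hfilt T' hT', h]
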